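/- Let $(\mathbb{k},\mathbb{K})$ be one of the pairs $(\mathbb{R},\mathbb{R})$, $(\mathbb{C},\mathbb{C})$, $(\mathbb{R},\mathbb{C})$. Let $d,n,\ell\ge 0$ be integers with $\ell<d$, let $A$ be a $d\times(d+n)$ matrix with entries in $\mathbb{K}$, and let $p(x)=\det(x-AA^*)$. Let $U$ be a random $\ell\times d$ matrix and let $O$ be a random $(d+n)\times(\ell+n)$ matrix, both with entries in $\mathbb{k}$ and independent of each other, such that $U$ is uniformly distributed on the matrices with orthonormal rows and $O$ is uniformly distributed on the matrices with orthonormal columns; that is, $U$ has the law of the first $\ell$ rows of a Haar distributed $d\times d$ matrix, and $O$ the law of the first $\ell+n$ columns of a Haar distributed $(d+n)\times(d+n)$ matrix, in the orthogonal group if $\mathbb{k}=\mathbb{R}$ and in the unitary group if $\mathbb{k}=\mathbb{C}$. Let $M_n=xD^2+(n+1)D$, where $D=\frac{d}{dx}$. Then, for every $x\in\mathbb{K}$, the random variable $\det\left(x-(UAO)(UAO)^*\right)$ is integrable and $$\mathbb{E}\det\left(x-(UAO)(UAO)^*\right)=\frac{\ell!\,(\ell+n)!}{d!\,(d+n)!}\,\left(M_n^{d-\ell}p\right)(x).$$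 -/

import Mathlib

open MeasureTheory ProbabilityTheory Polynomial
open scoped Matrix

namespace RectCompression

/-- Matrices carry the entrywise (product) measurable structure. -/
instance instMeasurableSpaceMatrix {m n α : Type*} [MeasurableSpace α] :
    MeasurableSpace (Matrix m n α) :=
  inferInstanceAs (MeasurableSpace (m → n → α))

instance instBorelSpaceMatrix {m n α : Type*} [Countable m] [Countable n]
    [MeasurableSpace α] [TopologicalSpace α] [SecondCountableTopology α] [BorelSpace α] :
    BorelSpace (Matrix m n α) :=
  inferInstanceAs (BorelSpace (m → n → α))

/-- The unitary group `U(d)` over `𝕜` (the orthogonal group `O(d)` if `𝕜 = ℝ`) is compact. -/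
instance instCompactSpaceUnitaryGroup (𝕜 : Type*) [RCLike 𝕜] (d : ℕ) :
    CompactSpace (Matrix.unitaryGroup (Fin d) 𝕜) := by
  have hK : IsCompact (Set.univ.pi fun _ : Fin d => Set.univ.pi fun _ : Fin d =>
      Metric.closedBall (0 : 𝕜) 1) :=
    isCompact_univ_pi fun _ => isCompact_univ_pi fun _ => isCompact_closedBall _ _
  have hcl : IsClosed {V : Matrix (Fin d) (Fin d) 𝕜 | V * star V = 1} :=
    isClosed_eq (by fun_prop) continuous_const
  have hset : ((Matrix.unitaryGroup (Fin d) 𝕜 : Set (Matrix (Fin d) (Fin d) 𝕜)))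
      = {V | V * star V = 1} := by
    ext V
    exact Matrix.mem_unitaryGroup_iff
  have hc : IsCompact (Matrix.unitaryGroup (Fin d) 𝕜 : Set (Matrix (Fin d) (Fin d) 𝕜)) := by
    refine IsCompact.of_isClosed_subset (X := Matrix (Fin d) (Fin d) 𝕜) hK (hset ▸ hcl) ?_
    intro V hV i _ j _
    simpa using entry_norm_bound_of_unitary hV i j
  exact isCompact_iff_compactSpace.mp hc

/-- The Haar probability measure on the unitary group `U(d)` over `𝕜`
(on the orthogonal group `O(d)` if `𝕜 = ℝ`): the Haar measure of total mass one. -/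
noncomputable def haarUnitary (𝕜 : Type*) [RCLike 𝕜] [MeasurableSpace 𝕜] [BorelSpace 𝕜] (d : ℕ) :
    Measure (Matrix.unitaryGroup (Fin d) 𝕜) :=
  Measure.haarMeasure ⊤

/-- The uniform distribution on the `ℓ × d` matrices over `𝕜` with orthonormal rows:
the law of the first `ℓ` rows of a Haar distributed `d × d` unitary matrix. -/
noncomputable def uniformOrthonormalRows (𝕜 : Type*) [RCLike 𝕜] [MeasurableSpace 𝕜] [BorelSpace 𝕜]
    {ℓ d : ℕ} (h : ℓ ≤ d) : Measure (Matrix (Fin ℓ) (Fin d) 𝕜) :=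
  (haarUnitary 𝕜 d).map
    fun V : Matrix.unitaryGroup (Fin d) 𝕜 => V.1.submatrix (Fin.castLE h) id

/-- The uniform distribution on the `d × ℓ` matrices over `𝕜` with orthonormal columns:
the law of the first `ℓ` columns of a Haar distributed `d × d` unitary matrix. -/
noncomputable def uniformOrthonormalColumns (𝕜 : Type*) [RCLike 𝕜] [MeasurableSpace 𝕜]
    [BorelSpace 𝕜] {ℓ d : ℕ} (h : ℓ ≤ d) : Measure (Matrix (Fin d) (Fin ℓ) 𝕜) :=
  (haarUnitary 𝕜 d).map
    fun V : Matrix.unitaryGroup (Fin d) 𝕜 => V.1.submatrix id (Fin.castLE h)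

/-- The differential operator `M_a = x D² + (a + 1) D` on polynomials. -/
noncomputable def rectDerivative {R : Type*} [CommRing R] (a : R) : R[X] →ₗ[R] R[X] :=
  LinearMap.mulLeft R X ∘ₗ derivative ∘ₗ derivative + (a + 1) • derivative

end RectCompression

/-!
Up to signs, the coefficients of `det (x - M)` are the traces of the compound matrices `Λᵏ M`, and
`Λᵏ` is multiplicative by the Cauchy–Binet formula. For `C = U A O` the trace of `Λᵏ (C Cᴴ)` is
therefore bilinear in the independent matrices `Λᵏ (Uᴴ U)` and `Λᵏ (O Oᴴ)`, and may be averaged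
over each of them separately. By invariance of Haar measure, the mean of `Λᵏ (Uᴴ U)` commutes with
`Λᵏ Q` for every unitary `Q`; taking for `Q` sign changes and permutations of the coordinates
already shows that it is scalar, and its trace gives the scalar `(ℓ choose k) / (d choose k)`. The
mean of `Λᵏ (O Oᴴ)` is likewise the scalar `(ℓ + n choose k) / (d + n choose k)`. So averaging
multiplies the `k`-th coefficient of the characteristic polynomial by the product of these two
ratios, which is also how `M_n ^ (d - ℓ)`, being diagonal on monomials, acts on `x ^ (d - k)` up to
the constant factor.
-/

namespace RectCompression

open Set.powersetCard (ofFinEmbEquiv)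

section CompoundMatrix

variable {R : Type*} [CommRing R] {l m n : Type*} [LinearOrder l] [LinearOrder m] [LinearOrder n]

/-- The `k`-th compound matrix of `A`, whose entries are the `k × k` minors of `A`. Rows and columns
are indexed by the `k`-element subsets of the index types, each listed in increasing order. -/
def compoundMatrix (k : ℕ) (A : Matrix m n R) :
    Matrix (Set.powersetCard m k) (Set.powersetCard n k) R :=
  Matrix.of fun s t => (A.submatrix (ofFinEmbEquiv.symm s) (ofFinEmbEquiv.symm t)).det

theorem compoundMatrix_apply (k : ℕ) (A : Matrix m n R) (s : Set.powersetCard m k)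
    (t : Set.powersetCard n k) :
    compoundMatrix k A s t = (A.submatrix (ofFinEmbEquiv.symm s) (ofFinEmbEquiv.symm t)).det :=
  rfl

theorem toMatrix_exteriorPower_map [Finite m] [Fintype n] (k : ℕ) (A : Matrix m n R) :
    LinearMap.toMatrix ((Pi.basisFun R n).exteriorPower k) ((Pi.basisFun R m).exteriorPower k)
      (exteriorPower.map k A.toLin') = compoundMatrix k A := by
  ext s t
  rw [LinearMap.toMatrix_apply, exteriorPower.basis_repr_apply, exteriorPower.basis_apply,
    exteriorPower.map_apply_ιMulti_family, exteriorPower.ιMulti_family,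
    exteriorPower.ιMultiDual_apply_ιMulti, compoundMatrix_apply, ← Matrix.det_transpose]
  congr 1
  ext i j
  simp

/-- The Cauchy–Binet formula: taking exterior powers is functorial. -/
theorem compoundMatrix_mul [Finite l] [Fintype m] [Finite n] (k : ℕ) (A : Matrix l m R)
    (B : Matrix m n R) : compoundMatrix k (A * B) = compoundMatrix k A * compoundMatrix k B := by
  have := Fintype.ofFinite n
  simp only [← toMatrix_exteriorPower_map]
  rw [Matrix.toLin'_mul, exteriorPower.map_comp,
    LinearMap.toMatrix_comp _ ((Pi.basisFun R m).exteriorPower k)]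

theorem compoundMatrix_map {S : Type*} [CommRing S] (f : R →+* S) (k : ℕ) (A : Matrix m n R) :
    compoundMatrix k (A.map f) = (compoundMatrix k A).map f := by
  ext s t
  simp [compoundMatrix_apply, RingHom.map_det, Matrix.submatrix_map]

theorem compoundMatrix_conjTranspose [StarRing R] (k : ℕ) (A : Matrix m n R) :
    compoundMatrix k Aᴴ = (compoundMatrix k A)ᴴ := by
  ext s t
  rw [Matrix.conjTranspose_apply, compoundMatrix_apply, compoundMatrix_apply,
    ← Matrix.det_conjTranspose, Matrix.conjTranspose_submatrix]

theorem compoundMatrix_diagonal (k : ℕ) (v : m → R) :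
    compoundMatrix k (Matrix.diagonal v) =
      Matrix.diagonal fun s => ∏ i, v (ofFinEmbEquiv.symm s i) := by
  ext s t
  rw [compoundMatrix_apply]
  rcases eq_or_ne s t with rfl | hst
  · rw [Matrix.diagonal_apply_eq, ← Matrix.det_diagonal]
    congr 1
    exact Matrix.submatrix_diagonal_embedding v (ofFinEmbEquiv.symm s).toEmbedding
  · obtain ⟨a, has, hat⟩ := (Set.powersetCard.exists_mem_notMem_iff_ne s t).1 hst
    obtain ⟨i, rfl⟩ := (Set.powersetCard.mem_range_ofFinEmbEquiv_symm_iff_mem s a).2 has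
    rw [Matrix.diagonal_apply_ne _ hst]
    refine Matrix.det_eq_zero_of_row_eq_zero i fun j => Matrix.diagonal_apply_ne _ fun hij => hat ?_
    exact (Set.powersetCard.mem_range_ofFinEmbEquiv_symm_iff_mem t _).1 ⟨j, hij.symm⟩

theorem compoundMatrix_one (k : ℕ) : compoundMatrix k (1 : Matrix m m R) = 1 := by
  simp [← Matrix.diagonal_one, compoundMatrix_diagonal]

@[fun_prop]
theorem continuous_compoundMatrix [TopologicalSpace R] [IsTopologicalRing R] (k : ℕ) :
    Continuous (compoundMatrix k : Matrix m n R → _) :=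
  continuous_matrix fun _ _ => (continuous_id.matrix_submatrix _ _).matrix_det

theorem trace_compoundMatrix [Fintype m] (k : ℕ) (A : Matrix m m R) :
    (compoundMatrix k A).trace = ∑ s ∈ Finset.univ.powersetCard k,
      (A.submatrix (Subtype.val : s → m) (Subtype.val : s → m)).det := by
  rw [← Finset.sum_coe_sort, Matrix.trace]
  refine Fintype.sum_equiv (Equiv.subtypeEquivRight fun s => by simp [Set.powersetCard])
    _ _ fun s => ?_
  exact Matrix.det_submatrix_equiv_self (Finset.orderIsoOfFin s.1 s.2).toEquiv
    (A.submatrix (Subtype.val : s.1 → m) (Subtype.val : s.1 → m))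

theorem trace_compoundMatrix_mul_comm [Fintype m] [Fintype n] (k : ℕ) (A : Matrix m n R)
    (B : Matrix n m R) :
    (compoundMatrix k (A * B)).trace = (compoundMatrix k (B * A)).trace := by
  rw [compoundMatrix_mul, compoundMatrix_mul, Matrix.trace_mul_comm]

theorem charpoly_eq_sum_trace_compoundMatrix [Fintype m] (A : Matrix m m R) :
    A.charpoly = ∑ k ∈ Finset.range (Fintype.card m + 1),
      C ((-1) ^ k * (compoundMatrix k A).trace) * X ^ (Fintype.card m - k) := by
  nontriviality R
  conv_lhs => rw [A.charpoly.as_sum_range_C_mul_X_pow, A.charpoly_natDegree_eq_dim]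
  rw [← Finset.sum_range_reflect]
  refine Finset.sum_congr rfl fun k hk => ?_
  have hkm : k ≤ Fintype.card m := Finset.mem_range_succ_iff.1 hk
  rw [Nat.add_sub_cancel, A.charpoly_coeff_eq_sum_minors k hkm, trace_compoundMatrix]

theorem det_scalar_sub_eq_sum_trace_compoundMatrix [Fintype m] (A : Matrix m m R) (x : R) :
    (Matrix.scalar m x - A).det = ∑ k ∈ Finset.range (Fintype.card m + 1),
      (-1) ^ k * (compoundMatrix k A).trace * x ^ (Fintype.card m - k) := by
  rw [← Matrix.eval_charpoly, charpoly_eq_sum_trace_compoundMatrix, eval_finsetSum]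
  simp

theorem trace_compoundMatrix_one [Fintype m] (k : ℕ) :
    (compoundMatrix k (1 : Matrix m m R)).trace = (Fintype.card m).choose k := by
  rw [compoundMatrix_one, Matrix.trace_one, Fintype.card_eq_nat_card, Set.powersetCard.card,
    Nat.card_eq_fintype_card]

end CompoundMatrix

section RectDerivative

theorem rectDerivative_X_pow {R : Type*} [CommRing R] (a : R) (m : ℕ) :
    rectDerivative a (X ^ m) = C (m * (m + a)) * X ^ (m - 1) := by
  rcases m with _ | _ | m
  · simp [rectDerivative]
  · simp [rectDerivative, smul_eq_C_mul, add_comm]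
  · simp only [rectDerivative, LinearMap.add_apply, LinearMap.coe_comp, Function.comp_apply,
      derivative_X_pow_succ, derivative_mul, derivative_C, LinearMap.mulLeft_apply,
      LinearMap.smul_apply, smul_eq_C_mul, Nat.cast_add, Nat.cast_one, map_add, map_mul, map_one,
      derivative_one, add_tsub_cancel_right]
    ring

theorem rectDerivative_pow_X_pow {R : Type*} [CommRing R] (n m j : ℕ) :
    (rectDerivative (n : R) ^ j) (X ^ m) =
      C ((m.descFactorial j * (m + n).descFactorial j : ℕ) : R) * X ^ (m - j) := by
  induction j with
  | zero => simp
  | succ j ih =>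
    rw [pow_succ', Module.End.mul_apply, ih, ← smul_eq_C_mul, map_smul, rectDerivative_X_pow,
      smul_eq_C_mul, ← mul_assoc, ← C_mul, ← Nat.cast_add, ← Nat.cast_mul, ← Nat.cast_mul,
      Nat.sub_sub]
    congr 3
    rcases le_or_gt j m with hjm | hmj
    · rw [Nat.descFactorial_succ, Nat.descFactorial_succ, Nat.sub_add_comm hjm]
      ring
    · simp [Nat.descFactorial_of_lt hmj]

theorem factorial_mul_descFactorial_mul_choose {d ℓ k : ℕ} (hℓ : ℓ ≤ d) (hk : k ≤ d) :
    ℓ.factorial * (d - k).descFactorial (d - ℓ) * d.choose k = d.factorial * ℓ.choose k := by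
  rcases le_or_gt k ℓ with hkℓ | hℓk
  · have hdesc := Nat.factorial_mul_descFactorial (show d - ℓ ≤ d - k by lia)
    rw [show d - k - (d - ℓ) = ℓ - k by lia] at hdesc
    rw [← Nat.choose_mul_factorial_mul_factorial hk, ← hdesc,
      ← Nat.choose_mul_factorial_mul_factorial hkℓ]
    ring
  · rw [Nat.descFactorial_of_lt (by lia), Nat.choose_eq_zero_of_lt hℓk]
    simp

variable {K : Type*} [Field K] [CharZero K] {d ℓ : ℕ}

theorem factorial_div_factorial_mul_descFactorial (n : ℕ) (hℓ : ℓ ≤ d) {k : ℕ} (hk : k ≤ d) :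
    (ℓ.factorial * (ℓ + n).factorial : K) / (d.factorial * (d + n).factorial) *
        ((d - k).descFactorial (d - ℓ) * (d - k + n).descFactorial (d - ℓ) : ℕ) =
      (ℓ.choose k * (ℓ + n).choose k) / (d.choose k * (d + n).choose k) := by
  have hkn : k ≤ d + n := hk.trans (Nat.le_add_right d n)
  have h₁ := congrArg (Nat.cast : ℕ → K) (factorial_mul_descFactorial_mul_choose hℓ hk)
  have h₂ := congrArg (Nat.cast : ℕ → K)
    (factorial_mul_descFactorial_mul_choose (Nat.add_le_add_right hℓ n) hkn)
  rw [Nat.add_sub_add_right, Nat.sub_add_comm hk] at h₂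
  push_cast at h₁ h₂ ⊢
  rw [div_mul_eq_mul_div, div_eq_div_iff (by simp [Nat.factorial_ne_zero])
    (by simp [(Nat.choose_pos hk).ne', (Nat.choose_pos hkn).ne'])]
  linear_combination (ℓ + n).factorial * (d - k + n).descFactorial (d - ℓ) * (d + n).choose k * h₁
    + d.factorial * ℓ.choose k * h₂

theorem eval_rectDerivative_pow_charpoly (n : ℕ) (hℓ : ℓ ≤ d) {m : Type*} [LinearOrder m]
    [Fintype m] (hm : Fintype.card m = d) (M : Matrix m m K) (x : K) :
    (ℓ.factorial * (ℓ + n).factorial : K) / (d.factorial * (d + n).factorial) *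
      ((rectDerivative (n : K) ^ (d - ℓ)) M.charpoly).eval x =
    ∑ k ∈ Finset.range (ℓ + 1), (-1) ^ k *
      ((ℓ.choose k * (ℓ + n).choose k : K) / (d.choose k * (d + n).choose k) *
        (compoundMatrix k M).trace) * x ^ (ℓ - k) := by
  rw [charpoly_eq_sum_trace_compoundMatrix, map_sum, eval_finsetSum, Finset.mul_sum, hm,
    Finset.sum_subset (Finset.range_mono (Nat.succ_le_succ hℓ))
      fun k _ hk => by simp [Nat.choose_eq_zero_of_lt (show ℓ < k by simpa using hk)]]
  refine Finset.sum_congr rfl fun k hk => ?_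
  rw [← factorial_div_factorial_mul_descFactorial n hℓ (Finset.mem_range_succ_iff.1 hk),
    ← smul_eq_C_mul, map_smul, rectDerivative_pow_X_pow, show d - k - (d - ℓ) = ℓ - k by lia]
  simp only [smul_eq_C_mul, eval_mul, eval_C, eval_pow, eval_X]
  ring

end RectDerivative

section Schur

theorem diagonal_sign_mem_unitaryGroup {R m : Type*} [CommRing R] [StarRing R] [Fintype m]
    [DecidableEq m] (a : m) :
    Matrix.diagonal (Function.update (1 : m → R) a (-1)) ∈ Matrix.unitaryGroup m R := by
  rw [Matrix.mem_unitaryGroup_iff, Matrix.star_eq_conjTranspose, Matrix.diagonal_conjTranspose,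
    Matrix.diagonal_mul_diagonal, ← Matrix.diagonal_one]
  congr 1
  ext j
  rcases eq_or_ne j a with rfl | hj <;> simp [*]

theorem permMatrix_mem_unitaryGroup {R m : Type*} [CommRing R] [StarRing R] [Fintype m]
    [DecidableEq m] (σ : Equiv.Perm m) : σ.permMatrix R ∈ Matrix.unitaryGroup m R := by
  rw [Matrix.mem_unitaryGroup_iff, Matrix.star_eq_conjTranspose, Matrix.conjTranspose_permMatrix,
    ← Matrix.permMatrix_mul, inv_mul_cancel, Matrix.permMatrix_one]

variable {K m : Type*} [Field K] [StarRing K] [LinearOrder m] [Fintype m] {k : ℕ}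
  {B : Matrix (Set.powersetCard m k) (Set.powersetCard m k) K}

theorem apply_eq_zero_of_commute_compoundMatrix [CharZero K]
    (hB : ∀ Q ∈ Matrix.unitaryGroup m K, Commute B (compoundMatrix k Q))
    {s t : Set.powersetCard m k} (hst : s ≠ t) : B s t = 0 := by
  obtain ⟨a, has, hat⟩ := (Set.powersetCard.exists_mem_notMem_iff_ne s t).1 hst
  obtain ⟨i, rfl⟩ := (Set.powersetCard.mem_range_ofFinEmbEquiv_symm_iff_mem s a).2 has
  let v : m → K := Function.update 1 (ofFinEmbEquiv.symm s i) (-1)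
  have hs : ∏ j, v (ofFinEmbEquiv.symm s j) = -1 := by
    rw [Finset.prod_eq_single_of_mem i (Finset.mem_univ i)] <;>
      simp +contextual [v]
  have ht : ∏ j, v (ofFinEmbEquiv.symm t j) = 1 := by
    refine Finset.prod_eq_one fun j _ => Function.update_of_ne (fun hj => hat ?_) _ _
    exact (Set.powersetCard.mem_range_ofFinEmbEquiv_symm_iff_mem t _).1 ⟨j, hj⟩
  have h := congrFun₂ (hB _ (diagonal_sign_mem_unitaryGroup (ofFinEmbEquiv.symm s i))).eq s t
  rw [compoundMatrix_diagonal, Matrix.mul_diagonal, Matrix.diagonal_mul, hs, ht, mul_one,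
    neg_one_mul] at h
  exact CharZero.eq_neg_self_iff.1 h

theorem apply_self_eq_of_commute_compoundMatrix
    (hB : ∀ Q ∈ Matrix.unitaryGroup m K, Commute B (compoundMatrix k Q))
    (s t : Set.powersetCard m k) : B s s = B t t := by
  obtain ⟨σ, hσ⟩ := (Equiv.Perm.isMultiplyPretransitive m k).exists_smul_eq
    (ofFinEmbEquiv.symm s).toEmbedding (ofFinEmbEquiv.symm t).toEmbedding
  have hσ' (i) : σ (ofFinEmbEquiv.symm s i) = ofFinEmbEquiv.symm t i := DFunLike.congr_fun hσ i
  have hrow (u) : compoundMatrix k (σ.permMatrix K) s u = (1 : Matrix _ _ K) t u := by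
    rw [← compoundMatrix_one, compoundMatrix_apply, compoundMatrix_apply]
    congr 1
    ext i j
    simp [PEquiv.toMatrix_apply, Matrix.one_apply, hσ']
  have hcol (u) : compoundMatrix k (σ.permMatrix K) u t = (1 : Matrix _ _ K) u s := by
    rw [← compoundMatrix_one, compoundMatrix_apply, compoundMatrix_apply]
    congr 1
    ext i j
    simp [PEquiv.toMatrix_apply, Matrix.one_apply, ← hσ', eq_comm]
  have h := congrFun₂ (hB _ (permMatrix_mem_unitaryGroup σ)).eq s t
  simpa [Matrix.mul_apply, hrow, hcol, Matrix.one_apply] using h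

theorem eq_smul_one_of_commute_compoundMatrix [CharZero K]
    (hB : ∀ Q ∈ Matrix.unitaryGroup m K, Commute B (compoundMatrix k Q)) :
    B = (B.trace / (Fintype.card m).choose k) • 1 := by
  ext s t
  rcases eq_or_ne s t with rfl | hst
  · have hdiag (t) : B t t = B s s := apply_self_eq_of_commute_compoundMatrix hB t s
    have htrace : B.trace = (compoundMatrix k (1 : Matrix m m K)).trace * B s s := by
      simp [compoundMatrix_one, Matrix.trace, hdiag]
    have hchoose : ((Fintype.card m).choose k : K) ≠ 0 := by
      rw [← trace_compoundMatrix_one, compoundMatrix_one, Matrix.trace_one]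
      exact Nat.cast_ne_zero.2 (Fintype.card_pos_iff.2 ⟨s⟩).ne'
    rw [htrace, trace_compoundMatrix_one, mul_div_cancel_left₀ _ hchoose]
    simp
  · simp [apply_eq_zero_of_commute_compoundMatrix hB hst, hst]

end Schur

section Compression

variable {R S : Type*} [CommRing R] [CommRing S] [Algebra R S] {l m n o : Type*} [Fintype m]
  [Fintype n]

/-- The compression `X A Y` of a matrix `A` by matrices `X` and `Y` over a ring of scalars. -/
def compression (A : Matrix m n S) (X : Matrix l m R) (Y : Matrix n o R) : Matrix l o S :=
  X.map (algebraMap R S) * A * Y.map (algebraMap R S)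

theorem trace_compoundMatrix_compression_mul_conjTranspose [StarRing R] [StarRing S]
    [StarModule R S] [LinearOrder l] [LinearOrder m] [LinearOrder n] [Fintype l] [Fintype o]
    (k : ℕ) (A : Matrix m n S) (X : Matrix l m R) (Y : Matrix n o R) :
    (compoundMatrix k (compression A X Y * (compression A X Y)ᴴ)).trace =
      ((compoundMatrix k A)ᴴ * (compoundMatrix k (Xᴴ * X)).map (algebraMap R S) *
        compoundMatrix k A * (compoundMatrix k (Y * Yᴴ)).map (algebraMap R S)).trace := by
  have hstar : Function.Semiconj (algebraMap R S) star star := algebraMap_star_comm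
  have hcycle : compression A X Y * (compression A X Y)ᴴ = X.map (algebraMap R S) *
      (A * (Y * Yᴴ).map (algebraMap R S) * Aᴴ * Xᴴ.map (algebraMap R S)) := by
    simp only [compression, Matrix.conjTranspose_mul, Matrix.map_mul,
      Matrix.conjTranspose_map _ hstar, Matrix.mul_assoc]
  rw [hcycle, trace_compoundMatrix_mul_comm, Matrix.mul_assoc, ← Matrix.map_mul,
    Matrix.mul_assoc, trace_compoundMatrix_mul_comm, ← compoundMatrix_map, ← compoundMatrix_map,
    ← compoundMatrix_conjTranspose, ← compoundMatrix_mul, ← compoundMatrix_mul,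
    ← compoundMatrix_mul, Matrix.mul_assoc (Aᴴ * _)]

theorem isBilinearMap_trace_mul_map_mul_mul_map (M : Matrix n m S) (N : Matrix m n S) :
    IsBilinearMap R fun (X : Matrix m m R) (Y : Matrix n n R) =>
      (M * X.map (algebraMap R S) * N * Y.map (algebraMap R S)).trace where
  add_left _ _ _ := by simp [Matrix.map_add, Matrix.mul_add, Matrix.add_mul]
  smul_left _ _ _ := by simp [Matrix.map_smul', Algebra.smul_def]
  add_right _ _ _ := by simp [Matrix.map_add, Matrix.mul_add]
  smul_right _ _ _ := by simp [Matrix.map_smul', Algebra.smul_def]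

end Compression

section HaarProbability

variable {G : Type*} [Group G] [TopologicalSpace G] [IsTopologicalGroup G] [CompactSpace G]
  [MeasurableSpace G] [BorelSpace G] (μ : Measure G) [μ.IsHaarMeasure] [IsProbabilityMeasure μ]

theorem isMulRightInvariant_of_isProbabilityMeasure : μ.IsMulRightInvariant where
  map_mul_right_eq_self g := by
    have : IsProbabilityMeasure (μ.map (· * g)) :=
      Measure.isProbabilityMeasure_map (by fun_prop)
    exact Measure.isHaarMeasure_eq_of_isProbabilityMeasure _ _

theorem isInvInvariant_of_isProbabilityMeasure : μ.IsInvInvariant where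
  inv_eq_self := by
    have : μ.IsMulRightInvariant := isMulRightInvariant_of_isProbabilityMeasure μ
    have : IsProbabilityMeasure μ.inv :=
      Measure.isProbabilityMeasure_map (by fun_prop)
    have : μ.inv.IsHaarMeasure :=
      Measure.isHaarMeasure_of_isCompact_nonempty_interior _ Set.univ isCompact_univ
        (by simp) (by simp) (by simp)
    exact Measure.isHaarMeasure_eq_of_isProbabilityMeasure _ _

end HaarProbability

section HaarUnitary

open scoped Matrix.Norms.L2Operator

variable {𝕜 : Type*} [RCLike 𝕜]

noncomputable local instance instL2OpNormedAlgebraReal {m : Type*} [Fintype m] [DecidableEq m] :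
    NormedAlgebra ℝ (Matrix m m 𝕜) where
  norm_smul_le r A := by
    rw [← algebraMap_smul 𝕜 r A, norm_smul, norm_algebraMap']

theorem trace_integral {α m : Type*} [MeasurableSpace α] [Fintype m] [DecidableEq m] {μ : Measure α}
    {f : α → Matrix m m 𝕜} (hf : Integrable f μ) :
    (∫ x, f x ∂μ).trace = ∫ x, (f x).trace ∂μ :=
  ((Matrix.traceLinearMap m 𝕜 𝕜).toContinuousLinearMap.integral_comp_comm hf).symm

instance instSecondCountableTopologyMatrix {m n α : Type*} [Countable m] [Countable n]
    [TopologicalSpace α] [SecondCountableTopology α] : SecondCountableTopology (Matrix m n α) :=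
  inferInstanceAs (SecondCountableTopology (m → n → α))

variable [MeasurableSpace 𝕜] [BorelSpace 𝕜] {ℓ d : ℕ}

instance instIsHaarMeasureHaarUnitary : (haarUnitary 𝕜 d).IsHaarMeasure :=
  Measure.isHaarMeasure_haarMeasure _

instance instIsProbabilityMeasureHaarUnitary : IsProbabilityMeasure (haarUnitary 𝕜 d) :=
  ⟨Measure.haarMeasure_self⟩

instance instIsMulRightInvariantHaarUnitary : (haarUnitary 𝕜 d).IsMulRightInvariant :=
  isMulRightInvariant_of_isProbabilityMeasure _

instance instIsInvInvariantHaarUnitary : (haarUnitary 𝕜 d).IsInvInvariant :=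
  isInvInvariant_of_isProbabilityMeasure _

theorem measurable_submatrix_castLE (h : ℓ ≤ d) :
    Measurable fun V : Matrix.unitaryGroup (Fin d) 𝕜 => V.1.submatrix (Fin.castLE h) id :=
  Continuous.measurable (by fun_prop)

theorem integrable_compoundMatrix_conjTranspose_mul_mul (k : ℕ) (N : Matrix (Fin d) (Fin d) 𝕜) :
    Integrable (fun V => compoundMatrix k (V.1ᴴ * N * V.1)) (haarUnitary 𝕜 d) :=
  Continuous.integrable_of_hasCompactSupport (by fun_prop) (.of_compactSpace _)

theorem commute_integral_compoundMatrix_conjTranspose_mul_mul (k : ℕ)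
    (N : Matrix (Fin d) (Fin d) 𝕜) {Q : Matrix (Fin d) (Fin d) 𝕜}
    (hQ : Q ∈ Matrix.unitaryGroup (Fin d) 𝕜) :
    Commute (∫ V, compoundMatrix k (V.1ᴴ * N * V.1) ∂haarUnitary 𝕜 d) (compoundMatrix k Q) := by
  have hint := integrable_compoundMatrix_conjTranspose_mul_mul k N
  set T := ∫ V, compoundMatrix k (V.1ᴴ * N * V.1) ∂haarUnitary 𝕜 d
  have hinv : compoundMatrix k Qᴴ * T * compoundMatrix k Q = T := by
    rw [← integral_const_mul_of_integrable hint,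
      ← integral_mul_const_of_integrable (hint.const_mul _)]
    refine Eq.trans (integral_congr_ae (ae_of_all _ fun V => ?_))
      (integral_mul_right_eq_self _ (⟨Q, hQ⟩ : Matrix.unitaryGroup (Fin d) 𝕜))
    simp only [← compoundMatrix_mul, Submonoid.coe_mul, Matrix.conjTranspose_mul, Matrix.mul_assoc]
  have hQQ : compoundMatrix k Q * compoundMatrix k Qᴴ = 1 := by
    rw [← compoundMatrix_mul, ← Matrix.star_eq_conjTranspose, Matrix.mem_unitaryGroup_iff.1 hQ,
      compoundMatrix_one]
  calc T * compoundMatrix k Q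
      = compoundMatrix k Q * compoundMatrix k Qᴴ * T * compoundMatrix k Q := by rw [hQQ, one_mul]
    _ = compoundMatrix k Q * (compoundMatrix k Qᴴ * T * compoundMatrix k Q) := by
      simp only [Matrix.mul_assoc]
    _ = compoundMatrix k Q * T := by rw [hinv]

theorem integral_compoundMatrix_conjTranspose_mul_mul (k : ℕ) (N : Matrix (Fin d) (Fin d) 𝕜) :
    ∫ V, compoundMatrix k (V.1ᴴ * N * V.1) ∂haarUnitary 𝕜 d =
      ((compoundMatrix k N).trace / d.choose k : 𝕜) • 1 := by
  have htrace (V : Matrix.unitaryGroup (Fin d) 𝕜) :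
      (compoundMatrix k (V.1ᴴ * N * V.1)).trace = (compoundMatrix k N).trace := by
    rw [trace_compoundMatrix_mul_comm, ← Matrix.mul_assoc, ← Matrix.star_eq_conjTranspose,
      Matrix.mem_unitaryGroup_iff.1 V.2, Matrix.one_mul]
  rw [eq_smul_one_of_commute_compoundMatrix
      fun Q hQ => commute_integral_compoundMatrix_conjTranspose_mul_mul k N hQ,
    trace_integral (integrable_compoundMatrix_conjTranspose_mul_mul k N)]
  simp [htrace]

theorem measurable_conjTranspose {m n : Type*} [Countable m] [Countable n] :
    Measurable (Matrix.conjTranspose : Matrix m n 𝕜 → _) :=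
  Continuous.measurable (by fun_prop)

theorem map_conjTranspose_uniformOrthonormalColumns (h : ℓ ≤ d) :
    (uniformOrthonormalColumns 𝕜 h).map Matrix.conjTranspose = uniformOrthonormalRows 𝕜 h := by
  have hcolumns : Continuous fun V : Matrix.unitaryGroup (Fin d) 𝕜 =>
      V.1.submatrix id (Fin.castLE h) := by fun_prop
  rw [uniformOrthonormalColumns, uniformOrthonormalRows,
    Measure.map_map measurable_conjTranspose hcolumns.measurable]
  conv_rhs => rw [← Measure.map_inv_eq_self (haarUnitary 𝕜 d),
    Measure.map_map (measurable_submatrix_castLE h) measurable_inv]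
  rfl

theorem integrable_compoundMatrix_uniformOrthonormalRows (h : ℓ ≤ d) (k : ℕ) :
    Integrable (fun U => compoundMatrix k (Uᴴ * U)) (uniformOrthonormalRows 𝕜 h) := by
  rw [uniformOrthonormalRows, integrable_map_measure
    (Continuous.aestronglyMeasurable (by fun_prop)) (measurable_submatrix_castLE h).aemeasurable]
  exact Continuous.integrable_of_hasCompactSupport (by fun_prop) (.of_compactSpace _)

theorem integral_compoundMatrix_uniformOrthonormalRows (h : ℓ ≤ d) (k : ℕ) :
    ∫ U, compoundMatrix k (Uᴴ * U) ∂uniformOrthonormalRows 𝕜 h =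
      (ℓ.choose k / d.choose k : 𝕜) • 1 := by
  let E : Matrix (Fin ℓ) (Fin d) 𝕜 := (1 : Matrix (Fin d) (Fin d) 𝕜).submatrix (Fin.castLE h) id
  have hE : E * Eᴴ = 1 := by
    rw [Matrix.conjTranspose_submatrix, Matrix.conjTranspose_one,
      ← Matrix.submatrix_mul _ _ _ _ _ Function.bijective_id, Matrix.one_mul,
      Matrix.submatrix_one _ (Fin.castLE_injective h)]
  have hgram (V : Matrix (Fin d) (Fin d) 𝕜) :
      (V.submatrix (Fin.castLE h) id)ᴴ * V.submatrix (Fin.castLE h) id = Vᴴ * (Eᴴ * E) * V := by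
    have hV : V.submatrix (Fin.castLE h) id = E * V :=
      (Matrix.one_submatrix_mul _ (Equiv.refl _) V).symm
    rw [hV, Matrix.conjTranspose_mul]
    simp only [Matrix.mul_assoc]
  rw [uniformOrthonormalRows, integral_map (measurable_submatrix_castLE h).aemeasurable
    (Continuous.aestronglyMeasurable (by fun_prop))]
  simp only [hgram]
  rw [integral_compoundMatrix_conjTranspose_mul_mul, trace_compoundMatrix_mul_comm, hE,
    trace_compoundMatrix_one, Fintype.card_fin]

theorem integrable_compoundMatrix_uniformOrthonormalColumns (h : ℓ ≤ d) (k : ℕ) :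
    Integrable (fun O => compoundMatrix k (O * Oᴴ)) (uniformOrthonormalColumns 𝕜 h) := by
  have hrows := integrable_compoundMatrix_uniformOrthonormalRows (𝕜 := 𝕜) h k
  rw [← map_conjTranspose_uniformOrthonormalColumns] at hrows
  simpa [Function.comp_def] using hrows.comp_measurable measurable_conjTranspose

theorem integral_compoundMatrix_uniformOrthonormalColumns (h : ℓ ≤ d) (k : ℕ) :
    ∫ O, compoundMatrix k (O * Oᴴ) ∂uniformOrthonormalColumns 𝕜 h =
      (ℓ.choose k / d.choose k : 𝕜) • 1 := by
  rw [← integral_compoundMatrix_uniformOrthonormalRows h,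
    ← map_conjTranspose_uniformOrthonormalColumns, integral_map
    measurable_conjTranspose.aemeasurable (Continuous.aestronglyMeasurable (by fun_prop))]
  simp only [Matrix.conjTranspose_conjTranspose]

variable {𝕂 : Type*} [RCLike 𝕂] [NormedAlgebra 𝕜 𝕂] [StarModule 𝕜 𝕂] {a b c e : ℕ}
  {hab : a ≤ b} {hec : e ≤ c} {Ω : Type*} [MeasurableSpace Ω] {P : Measure Ω}
  {U : Ω → Matrix (Fin a) (Fin b) 𝕜} {O : Ω → Matrix (Fin c) (Fin e) 𝕜}
  (hU : HasLaw U (uniformOrthonormalRows 𝕜 hab) P)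
  (hO : HasLaw O (uniformOrthonormalColumns 𝕜 hec) P) (hUO : IndepFun U O P)
  (A : Matrix (Fin b) (Fin c) 𝕂) (k : ℕ)

include hU hO hUO

theorem integrable_trace_compoundMatrix_compression :
    Integrable (fun ω => (compoundMatrix k
      (compression A (U ω) (O ω) * (compression A (U ω) (O ω))ᴴ)).trace) P := by
  have hrows := integrable_compoundMatrix_uniformOrthonormalRows (𝕜 := 𝕜) hab k
  have hcolumns := integrable_compoundMatrix_uniformOrthonormalColumns (𝕜 := 𝕜) hec k
  have hUO' : IndepFun (fun ω => compoundMatrix k ((U ω)ᴴ * U ω))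
      (fun ω => compoundMatrix k (O ω * (O ω)ᴴ)) P :=
    hUO.comp (φ := fun X => compoundMatrix k (Xᴴ * X)) (ψ := fun Y => compoundMatrix k (Y * Yᴴ))
      (Continuous.measurable (by fun_prop)) (Continuous.measurable (by fun_prop))
  rw [← hU.map_eq] at hrows
  rw [← hO.map_eq] at hcolumns
  simp only [trace_compoundMatrix_compression_mul_conjTranspose]
  let B := (isBilinearMap_trace_mul_map_mul_mul_map (R := 𝕜) (compoundMatrix k A)ᴴ
    (compoundMatrix k A)).toContinuousBilinearMap
  exact hUO'.integrable_bilin (hrows.comp_aemeasurable hU.aemeasurable)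
    (hcolumns.comp_aemeasurable hO.aemeasurable) B

theorem integral_trace_compoundMatrix_compression :
    ∫ ω, (compoundMatrix k (compression A (U ω) (O ω) * (compression A (U ω) (O ω))ᴴ)).trace ∂P =
      (a.choose k * e.choose k) / (b.choose k * c.choose k) *
        (compoundMatrix k (A * Aᴴ)).trace := by
  let f (X : Matrix (Fin a) (Fin b) 𝕜) := compoundMatrix k (Xᴴ * X)
  let g (Y : Matrix (Fin c) (Fin e) 𝕜) := compoundMatrix k (Y * Yᴴ)
  have hf : Integrable f (uniformOrthonormalRows 𝕜 hab) :=
    integrable_compoundMatrix_uniformOrthonormalRows hab k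
  have hg : Integrable g (uniformOrthonormalColumns 𝕜 hec) :=
    integrable_compoundMatrix_uniformOrthonormalColumns hec k
  have hmeanU : ∫ ω, f (U ω) ∂P = (a.choose k / b.choose k : 𝕜) • 1 :=
    (hU.integral_comp hf.aestronglyMeasurable).trans
      (integral_compoundMatrix_uniformOrthonormalRows hab k)
  have hmeanO : ∫ ω, g (O ω) ∂P = (e.choose k / c.choose k : 𝕜) • 1 :=
    (hO.integral_comp hg.aestronglyMeasurable).trans
      (integral_compoundMatrix_uniformOrthonormalColumns hec k)
  let B := (isBilinearMap_trace_mul_map_mul_mul_map (R := 𝕜) (compoundMatrix k A)ᴴ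
    (compoundMatrix k A)).toContinuousBilinearMap
  calc ∫ ω, (compoundMatrix k
        (compression A (U ω) (O ω) * (compression A (U ω) (O ω))ᴴ)).trace ∂P
      = ∫ ω, B (f (U ω)) (g (O ω)) ∂P := by
        simp only [trace_compoundMatrix_compression_mul_conjTranspose]
        rfl
    _ = B (∫ ω, f (U ω) ∂P) (∫ ω, g (O ω) ∂P) :=
        hUO.integral_bilin_comp_comp hU.aemeasurable hO.aemeasurable (hU.map_eq ▸ hf)
          (hO.map_eq ▸ hg) B
    _ = (e.choose k / c.choose k : 𝕜) • (a.choose k / b.choose k : 𝕜) • B 1 1 := by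
        rw [hmeanU, hmeanO]
        simp only [map_smul, smul_apply]
    _ = (e.choose k / c.choose k : 𝕜) • (a.choose k / b.choose k : 𝕜) •
          (compoundMatrix k (A * Aᴴ)).trace := by
        have hB : B 1 1 = ((compoundMatrix k A)ᴴ * compoundMatrix k A).trace := by
          simp [B]
        rw [hB, Matrix.trace_mul_comm, ← compoundMatrix_conjTranspose, ← compoundMatrix_mul]
    _ = _ := by
        simp only [Algebra.smul_def, map_div₀, map_natCast]
        ring

end HaarUnitary

end RectCompression

open RectCompression

theorem mainTheorem12
    {𝕜 𝕂 : Type*} [RCLike 𝕜] [MeasurableSpace 𝕜] [BorelSpace 𝕜]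
    [RCLike 𝕂] [NormedAlgebra 𝕜 𝕂] [StarModule 𝕜 𝕂]
    (d n ℓ : ℕ) (hℓ : ℓ < d) (A : Matrix (Fin d) (Fin (d + n)) 𝕂)
    {Ω : Type*} [MeasurableSpace Ω] (P : Measure Ω) [IsProbabilityMeasure P]
    (U : Ω → Matrix (Fin ℓ) (Fin d) 𝕜) (O : Ω → Matrix (Fin (d + n)) (Fin (ℓ + n)) 𝕜)
    (hU : HasLaw U (RectCompression.uniformOrthonormalRows 𝕜 hℓ.le) P)
    (hO : HasLaw O
      (RectCompression.uniformOrthonormalColumns 𝕜 (Nat.add_le_add_right hℓ.le n)) P)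
    (hUO : IndepFun U O P) :
    let C : Ω → Matrix (Fin ℓ) (Fin (ℓ + n)) 𝕂 := fun ω =>
      (U ω).map (algebraMap 𝕜 𝕂) * A * (O ω).map (algebraMap 𝕜 𝕂)
    let p : 𝕂[X] := (A * Aᴴ).charpoly
    ∀ x : 𝕂,
      Integrable (fun ω => (Matrix.scalar (Fin ℓ) x - C ω * (C ω)ᴴ).det) P ∧
      ∫ ω, (Matrix.scalar (Fin ℓ) x - C ω * (C ω)ᴴ).det ∂P =
        (((ℓ.factorial : 𝕂) * ((ℓ + n).factorial : 𝕂)) /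
            ((d.factorial : 𝕂) * ((d + n).factorial : 𝕂))) *
          ((RectCompression.rectDerivative (n : 𝕂) ^ (d - ℓ)) p).eval x := by
  intro C p x
  have hdet (ω : Ω) : (Matrix.scalar (Fin ℓ) x - C ω * (C ω)ᴴ).det =
      ∑ k ∈ Finset.range (ℓ + 1),
        (-1) ^ k * (compoundMatrix k (C ω * (C ω)ᴴ)).trace * x ^ (ℓ - k) := by
    rw [det_scalar_sub_eq_sum_trace_compoundMatrix, Fintype.card_fin]
  have hintegrable (k : ℕ) :
      Integrable (fun ω => (-1) ^ k * (compoundMatrix k (C ω * (C ω)ᴴ)).trace * x ^ (ℓ - k)) P :=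
    ((integrable_trace_compoundMatrix_compression hU hO hUO A k).const_mul _).mul_const _
  have hintegral (k : ℕ) : ∫ ω, (compoundMatrix k (C ω * (C ω)ᴴ)).trace ∂P =
      (ℓ.choose k * (ℓ + n).choose k) / (d.choose k * (d + n).choose k) *
        (compoundMatrix k (A * Aᴴ)).trace :=
    integral_trace_compoundMatrix_compression hU hO hUO A k
  simp only [hdet]
  refine ⟨integrable_finsetSum _ fun k _ => hintegrable k, ?_⟩
  rw [integral_finsetSum _ fun k _ => hintegrable k,
    eval_rectDerivative_pow_charpoly n hℓ.le (Fintype.card_fin d)]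
  simp only [integral_mul_const, integral_const_mul, hintegral]
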